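/- Let $\Omega=\Omega_1\times\cdots\times\Omega_M$, where each $\Omega_i$ is a finite probability space (all subsets being events), and let $\Pr$ be the product probability measure on $\Omega$. For $\omega\in\Omega$ and $K\subseteq[M]=\{1,\dots,M\}$ put $[\omega]_K=\{\omega'\in\Omega:\ \omega'_i=\omega_i \text{ for all } i\in K\}$. Let $(\mathcal E_\alpha)_{\alpha\in\mathcal I}$ be a family of events in $\Omega$ with $\sum_{\alpha\in\mathcal I}\Pr(\mathcal E_\alpha)\le\mu$, where $\mu<\infty$. For $\omega\in\Omega$ let $Z=Z(\omega)=\max|\mathcal J|$, where the maximum is over all finite $\mathcal J\subseteq\mathcal I$ for which there are pairwise disjoint sets $K_\alpha\subseteq[M]$, $\alpha\in\mathcal J$, with $[\omega]_{K_\alpha}\subseteq\mathcal E_\alpha$ for all $\alpha\in\mathcal J$; this maximum exists for every $\omega$. Set $\varphi(x)=(1+x)\log(1+x)-x$. (i) For all $t>0$, if $\mu>0$, then $$\Pr(Z\ge\mu+t)\le\exp\bigl(-\varphi(t/\mu)\mu\bigr)=e^{-\mu}\Bigl(\frac{e\mu}{\mu+t}\Bigr)^{\mu+t}\le\min\Bigl\{\exp\Bigl(-\frac{t^2}{2(\mu+t/3)}\Bigr),\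 \Bigl(1+\frac{t}{2\mu}\Bigr)^{-t/2}\Bigr\},$$ and if $\mu=0$, then $\Pr(Z\ge\mu+t)=0$. (ii) For all integers $x\ge1$, $$\Pr(Z\ge x)\le\frac{\mu^x}{x!}\le\frac{1}{\sqrt{2\pi x}}\Bigl(\frac{e\mu}{x}\Bigr)^x .$$ -/

import Mathlib

open MeasureTheory

/-- The function `φ(x) = (1 + x) log (1 + x) - x`. -/
noncomputable def chernoffPhi (x : ℝ) : ℝ := (1 + x) * Real.log (1 + x) - x

/-- The cylinder `[ω]_K`: all sample points that agree with `ω` on the coordinates in `K`. -/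
def cylinderAt {M : ℕ} {Ω : Fin M → Type*} (ω : ∀ i, Ω i) (K : Finset (Fin M)) :
    Set (∀ i, Ω i) :=
  {ω' | ∀ i ∈ K, ω' i = ω i}

/-- At `ω`, the events `E α` with `α ∈ J` occur disjointly: there are pairwise disjoint sets of
coordinates `K α`, for `α ∈ J`, such that `[ω]_{K α} ⊆ E α`. -/
def OccurDisjointly {M : ℕ} {Ω : Fin M → Type*} {I : Type*} (E : I → Set (∀ i, Ω i))
    (ω : ∀ i, Ω i) (J : Finset I) : Prop :=
  ∃ K : I → Finset (Fin M),
    (∀ α ∈ J, ∀ β ∈ J, α ≠ β → Disjoint (K α) (K β)) ∧ ∀ α ∈ J, cylinderAt ω (K α) ⊆ E α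

/-- The set of sizes `|J|` of subfamilies `J` whose events occur disjointly at `ω`. -/
def disjointSizes {M : ℕ} {Ω : Fin M → Type*} {I : Type*} (E : I → Set (∀ i, Ω i))
    (ω : ∀ i, Ω i) : Set ℕ :=
  {n | ∃ J : Finset I, OccurDisjointly E ω J ∧ J.card = n}

/-- `Z(ω)`: the maximum number of the events `E α` that occur disjointly at `ω`. -/
noncomputable def maxDisjoint {M : ℕ} {Ω : Fin M → Type*} {I : Type*} (E : I → Set (∀ i, Ω i))
    (ω : ∀ i, Ω i) : ℕ :=
  sSup (disjointSizes E ω)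

/-! By the van den Berg–Kesten–Reimer (BKR) inequality and induction, the events of a finite `J`
occur disjointly with probability at most `∏ Pr(E α)`. A union bound over `x`-subsets of a finite
subfamily attaining every `Z(ω)` gives `μ ^ x / x!`. For Chernoff, every subset of a maximal `J`
also occurs disjointly, so `(1 + s) ^ Z ≤ ∑ s ^ |J|` over disjointly occurring `J`; its mean is at
most `∏ (1 + s Pr(E α)) ≤ exp (s μ)`.

BKR reduces to the cube by randomly exchanging coordinates of two independent samples. On the cube,
the wing vectors of `D` are independent for generic `t` and lie in `U ⊓ W`, where `U` is spanned by
the point masses on `A` and `W` by full tensors indexed by `B`. As `U ⊔ W` has dimension at least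
`|A ∪ -B|`, the dimension formula leaves `|D| ≤ |A ∩ -B|`. -/

/-! ### Linear algebra on the cube: Reimer's butterfly theorem. -/

/-- The function on the cube that is the product over the coordinates `i` of the indicator of `x i`
if `i ∈ S` and of the function with value `1` at `x i` and `t` at `!x i` if `i ∉ S`. -/
noncomputable def wingVector {M : ℕ} (t : ℝ) (S : Finset (Fin M)) (x : Fin M → Bool) :
    (Fin M → Bool) → ℝ :=
  fun σ => ∏ i, if i ∈ S then (if x i = σ i then 1 else 0) else (if x i = σ i then 1 else t)

/-- The determinant of these vectors is a polynomial in `t`, nonzero because at `t = 0` the matrix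
is the identity. -/
theorem exists_polynomial_wingVector_linearIndependent {M : ℕ}
    (S : (Fin M → Bool) → Finset (Fin M)) :
    ∃ p : Polynomial ℝ, p ≠ 0 ∧ ∀ t : ℝ, p.eval t ≠ 0 →
      LinearIndependent ℝ (fun x => wingVector t (S x) x) := by
  classical
  let N : Matrix (Fin M → Bool) (Fin M → Bool) (Polynomial ℝ) := Matrix.of fun x σ =>
    ∏ i, if i ∈ S x then (if x i = σ i then 1 else 0) else
      (if x i = σ i then 1 else Polynomial.X)
  have hN : ∀ t : ℝ, N.det.eval t = (Matrix.of fun x => wingVector t (S x) x).det := by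
    intro t
    rw [← Polynomial.coe_evalRingHom, RingHom.map_det]
    congr 1
    ext x σ
    simp only [N, RingHom.mapMatrix_apply, Matrix.map_apply, Matrix.of_apply, wingVector, map_prod]
    refine Finset.prod_congr rfl fun i _ => ?_
    split_ifs <;> simp
  refine ⟨N.det, fun h => ?_, fun t ht => ?_⟩
  · have h0 := hN 0
    have h1 : (Matrix.of fun x => wingVector 0 (S x) x) = 1 := by
      ext x σ
      simp only [Matrix.of_apply, wingVector, ite_self, Matrix.one_apply]
      by_cases hx : x = σ
      · simp [hx]
      · obtain ⟨i, hi⟩ := Function.ne_iff.1 hx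
        rw [if_neg hx]
        exact Finset.prod_eq_zero (Finset.mem_univ i) (by simp [hi])
    rw [h1, Matrix.det_one, h] at h0
    simp at h0
  · rw [hN] at ht
    exact Matrix.linearIndependent_rows_of_det_ne_zero ht

theorem card_le_finrank_of_linearIndependent {ι V : Type*} [AddCommGroup V] [Module ℝ V]
    [FiniteDimensional ℝ V] {f : ι → V} (hf : LinearIndependent ℝ f) (D : Finset ι)
    (W : Submodule ℝ V) (h : ∀ x ∈ D, f x ∈ W) : D.card ≤ Module.finrank ℝ W := by
  have h1 : LinearIndependent ℝ (fun x : D => (⟨f x, h x x.2⟩ : W)) :=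
    LinearIndependent.of_comp W.subtype (hf.comp _ Subtype.val_injective)
  simpa using h1.fintype_card_le_finrank

theorem wingVector_univ {M : ℕ} (t : ℝ) (x : Fin M → Bool) :
    wingVector t Finset.univ x = Pi.single x 1 := by
  ext σ
  simp only [wingVector, Finset.mem_univ, if_true, Pi.single_apply]
  by_cases hx : x = σ
  · simp [hx]
  · obtain ⟨i, hi⟩ := Function.ne_iff.1 hx
    rw [if_neg (Ne.symm hx)]
    exact Finset.prod_eq_zero (Finset.mem_univ i) (by simp [hi])

/-- Inverting the parameter replaces `x` by its antipode, up to scaling. -/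
theorem wingVector_inv_empty {M : ℕ} {t : ℝ} (ht : t ≠ 0) (x : Fin M → Bool) :
    wingVector t⁻¹ ∅ x = t⁻¹ ^ M • wingVector t ∅ (fun i => !x i) := by
  ext σ
  have h : (t⁻¹ : ℝ) ^ M = ∏ _i : Fin M, t⁻¹ := by simp
  rw [Pi.smul_apply, smul_eq_mul, h]
  simp only [wingVector, ← Finset.prod_mul_distrib]
  refine Finset.prod_congr rfl fun i _ => ?_
  rcases Bool.eq_false_or_eq_true (x i) with hx | hx <;>
    rcases Bool.eq_false_or_eq_true (σ i) with hs | hs <;> simp [hx, hs, ht]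

theorem wingVector_mem_span_single {M : ℕ} (t : ℝ) (S : Finset (Fin M)) (x : Fin M → Bool)
    (A : Set (Fin M → Bool)) (hA : ∀ σ, (∀ i ∈ S, σ i = x i) → σ ∈ A) :
    wingVector t S x ∈ Submodule.span ℝ (wingVector t Finset.univ '' A) := by
  classical
  have h : wingVector t S x =
      ∑ σ, wingVector t S x σ • (wingVector t Finset.univ σ : (Fin M → Bool) → ℝ) := by
    ext τ
    simp [wingVector_univ, Pi.single_apply]
  rw [h]
  refine Submodule.sum_mem _ fun σ _ => ?_
  by_cases hσ : σ ∈ A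
  · exact Submodule.smul_mem _ _ (Submodule.subset_span ⟨σ, hσ, rfl⟩)
  · have : ∃ i ∈ S, σ i ≠ x i := by
      by_contra! hc
      exact hσ (hA σ hc)
    obtain ⟨i, hi, hne⟩ := this
    have h0 : wingVector t S x σ = 0 :=
      Finset.prod_eq_zero (Finset.mem_univ i) (by simp [hi, Ne.symm hne])
    rw [h0, zero_smul]
    exact Submodule.zero_mem _

theorem wingVector_mem_span_empty {M : ℕ} {t : ℝ} (ht : 1 - t ^ 2 ≠ 0) (S : Finset (Fin M))
    (x : Fin M → Bool) (B : Set (Fin M → Bool)) (hB : ∀ σ, (∀ i ∉ S, σ i = x i) → σ ∈ B) :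
    wingVector t S x ∈ Submodule.span ℝ (wingVector t ∅ '' B) := by
  classical
  -- In a coordinate of `S`, the point mass at `x i` is `(e - t e') / (1 - t ^ 2)`, where `e` takes
  -- values `1, t` at `x i, !x i` and `e'` takes `t, 1`. Elsewhere the factor is already `e`, so
  -- only `τ` agreeing with `x` off `S` contribute.
  let c : (i : Fin M) → Bool → ℝ := fun i b =>
    if i ∈ S then (if x i = b then 1 / (1 - t ^ 2) else -t / (1 - t ^ 2))
      else (if x i = b then 1 else 0)
  have h : wingVector t S x =
      ∑ τ : Fin M → Bool, (∏ i, c i (τ i)) • (wingVector t ∅ τ : (Fin M → Bool) → ℝ) := by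
    ext σ
    simp only [Finset.sum_apply, Pi.smul_apply, smul_eq_mul, wingVector, ← Finset.prod_mul_distrib]
    rw [← Fintype.prod_sum
      (f := fun i b => c i b * (if i ∈ (∅ : Finset (Fin M)) then (if b = σ i then 1 else 0)
        else (if b = σ i then 1 else t)))]
    refine Finset.prod_congr rfl fun i _ => ?_
    rw [Fintype.sum_bool]
    by_cases hi : i ∈ S <;> rcases Bool.eq_false_or_eq_true (x i) with hx | hx <;>
      rcases Bool.eq_false_or_eq_true (σ i) with hs | hs <;> simp [c, hi, hx, hs] <;>
      field_simp <;> ring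
  rw [h]
  refine Submodule.sum_mem _ fun σ _ => ?_
  by_cases hσ : σ ∈ B
  · exact Submodule.smul_mem _ _ (Submodule.subset_span ⟨σ, hσ, rfl⟩)
  · have : ∃ i, i ∉ S ∧ σ i ≠ x i := by
      by_contra! hc
      exact hσ (hB σ hc)
    obtain ⟨i, hi, hne⟩ := this
    have h0 : ∏ i, c i (σ i) = 0 :=
      Finset.prod_eq_zero (Finset.mem_univ i) (by simp [c, hi, Ne.symm hne])
    rw [h0, zero_smul]
    exact Submodule.zero_mem _

/-- Reimer's butterfly theorem. -/
theorem card_le_card_inter_antipode {M : ℕ} (S : (Fin M → Bool) → Finset (Fin M))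
    (D A B : Finset (Fin M → Bool))
    (hA : ∀ x ∈ D, ∀ σ, (∀ i ∈ S x, σ i = x i) → σ ∈ A)
    (hB : ∀ x ∈ D, ∀ σ, (∀ i ∉ S x, σ i = x i) → σ ∈ B) :
    D.card ≤ (A.filter fun σ => (fun i => !σ i) ∈ B).card := by
  classical
  obtain ⟨p, hp, hpt⟩ := exists_polynomial_wingVector_linearIndependent S
  obtain ⟨q, hq, hqt⟩ := exists_polynomial_wingVector_linearIndependent
    (fun σ : Fin M → Bool => if σ ∈ A then Finset.univ else ∅)
  obtain ⟨t, ht1, htp, htq⟩ : ∃ t : ℝ, 1 < t ∧ p.eval t ≠ 0 ∧ q.eval t⁻¹ ≠ 0 := by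
    have hfin : ((p.roots.toFinset : Set ℝ) ∪ Inv.inv '' (q.roots.toFinset : Set ℝ)).Finite :=
      p.roots.toFinset.finite_toSet.union (q.roots.toFinset.finite_toSet.image _)
    obtain ⟨t, ht, hn⟩ := (Set.Ioi_infinite (1 : ℝ)).exists_notMem_finite hfin
    refine ⟨t, ht, fun h => hn (Or.inl ?_), fun h => hn (Or.inr ⟨t⁻¹, ?_, inv_inv t⟩)⟩
    · simpa [hp] using h
    · simpa [hq] using h
  have ht0 : t ≠ 0 := by positivity
  have ht2 : 1 - t ^ 2 ≠ 0 := by nlinarith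
  set U := Submodule.span ℝ (wingVector t (Finset.univ : Finset (Fin M)) '' (A : Set _)) with hU
  set W := Submodule.span ℝ (wingVector t (∅ : Finset (Fin M)) '' (B : Set _)) with hW
  have h1 : D.card ≤ Module.finrank ℝ (U ⊓ W : Submodule ℝ ((Fin M → Bool) → ℝ)) :=
    card_le_finrank_of_linearIndependent (hpt t htp) D _ fun x hx =>
      ⟨wingVector_mem_span_single t _ x _ (hA x hx), wingVector_mem_span_empty ht2 _ x _ (hB x hx)⟩
  let anti : (Fin M → Bool) → (Fin M → Bool) := fun σ i => !σ i
  have hanti : ∀ σ, anti (anti σ) = σ := fun σ => by simp [anti]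
  -- Independence is used at `t⁻¹`: point masses do not depend on the parameter, and inversion turns
  -- the tensors at `-B` into multiples of those at `B` with parameter `t`.
  have h2 : (A ∪ B.image anti).card ≤
      Module.finrank ℝ (U ⊔ W : Submodule ℝ ((Fin M → Bool) → ℝ)) := by
    refine card_le_finrank_of_linearIndependent (hqt t⁻¹ htq) _ _ fun σ hσ => ?_
    by_cases hσA : σ ∈ A
    · refine Submodule.mem_sup_left ?_
      simp only [hσA, if_true, wingVector_univ t⁻¹, ← wingVector_univ t]
      exact Submodule.subset_span ⟨σ, hσA, rfl⟩
    · refine Submodule.mem_sup_right ?_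
      obtain ⟨τ, hτ, rfl⟩ := Finset.mem_image.1 ((Finset.mem_union.1 hσ).resolve_left hσA)
      simp only [hσA, if_false]
      rw [wingVector_inv_empty ht0]
      refine Submodule.smul_mem _ _ (Submodule.subset_span ⟨τ, hτ, ?_⟩)
      rw [show (fun i => !anti τ i) = τ from hanti τ]
  have hUc : Module.finrank ℝ U ≤ A.card := by
    rw [hU, ← Finset.coe_image]
    exact (finrank_span_finset_le_card _).trans Finset.card_image_le
  have hWc : Module.finrank ℝ W ≤ B.card := by
    rw [hW, ← Finset.coe_image]
    exact (finrank_span_finset_le_card _).trans Finset.card_image_le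
  have h3 := Submodule.finrank_sup_add_finrank_inf_eq U W
  have h4 := Finset.card_union_add_card_inter A (B.image anti)
  have h5 : (B.image anti).card = B.card :=
    Finset.card_image_of_injective _ (Function.LeftInverse.injective hanti)
  have h6 : (A.filter fun σ => (fun i => !σ i) ∈ B) = A ∩ B.image anti := by
    ext σ
    simp only [Finset.mem_filter, Finset.mem_inter, Finset.mem_image, and_congr_right_iff]
    exact fun _ => ⟨fun h => ⟨_, h, hanti σ⟩, by rintro ⟨τ, h, rfl⟩; simpa [anti] using h⟩
  rw [h6]
  omega

/-! ### The BKR inequality in product spaces. -/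

/-- The disjoint occurrence `A □ B` of two events in a product space. -/
def disjointOccurrence {M : ℕ} {Ω : Fin M → Type*} (A B : Set (∀ i, Ω i)) : Set (∀ i, Ω i) :=
  {ω | ∃ K L : Finset (Fin M), Disjoint K L ∧ cylinderAt ω K ⊆ A ∧ cylinderAt ω L ⊆ B}

/-- Reimer's inequality `|A □ B| ≤ |A ∩ -B|` in the discrete cube. -/
theorem card_disjointOccurrence_le {M : ℕ} (A B D : Finset (Fin M → Bool))
    (hD : ∀ x ∈ D, x ∈ disjointOccurrence (A : Set (Fin M → Bool)) B) :
    D.card ≤ (A.filter fun σ => (fun i => !σ i) ∈ B).card := by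
  classical
  choose! K L hKL hK hL using hD
  refine card_le_card_inter_antipode K D A B (fun x hx σ hσ => hK x hx hσ)
    fun x hx σ hσ => hL x hx fun i hi => hσ i fun hiK => ?_
  exact Finset.disjoint_left.1 (hKL x hx) hiK hi

/-- The point with coordinates from `u` where `σ` is true and from `v` where `σ` is false. -/
def mixPoint {M : ℕ} {Ω : Fin M → Type*} (σ : Fin M → Bool) (u v : ∀ i, Ω i) : ∀ i, Ω i :=
  fun i => if σ i then u i else v i

theorem mixPoint_not {M : ℕ} {Ω : Fin M → Type*} (σ : Fin M → Bool) (u v : ∀ i, Ω i) :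
    mixPoint (fun i => !σ i) u v = mixPoint σ v u := by
  ext i
  rcases Bool.eq_false_or_eq_true (σ i) with h | h <;> simp [mixPoint, h]

/-- Exchanging the coordinates of two points where `σ` is false. -/
def mixEquiv {M : ℕ} {Ω : Fin M → Type*} (σ : Fin M → Bool) :
    ((∀ i, Ω i) × (∀ i, Ω i)) ≃ ((∀ i, Ω i) × (∀ i, Ω i)) where
  toFun q := (mixPoint σ q.1 q.2, mixPoint σ q.2 q.1)
  invFun q := (mixPoint σ q.1 q.2, mixPoint σ q.2 q.1)
  left_inv q := by
    ext i <;> rcases Bool.eq_false_or_eq_true (σ i) with h | h <;> simp [mixPoint, h]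
  right_inv q := by
    ext i <;> rcases Bool.eq_false_or_eq_true (σ i) with h | h <;> simp [mixPoint, h]

theorem mixPoint_mem_disjointOccurrence {M : ℕ} {Ω : Fin M → Type*} {A B : Set (∀ i, Ω i)}
    {u v : ∀ i, Ω i} {σ : Fin M → Bool} (h : mixPoint σ u v ∈ disjointOccurrence A B) :
    σ ∈ disjointOccurrence {τ : Fin M → Bool | mixPoint τ u v ∈ A} {τ | mixPoint τ u v ∈ B} := by
  obtain ⟨K, L, hKL, hK, hL⟩ := h
  exact ⟨K, L, hKL, fun τ hτ => hK fun i hi => by simp [mixPoint, hτ i hi],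
    fun τ hτ => hL fun i hi => by simp [mixPoint, hτ i hi]⟩

open Classical in
/-- The van den Berg–Kesten–Reimer inequality for product weights. -/
theorem sum_disjointOccurrence_le {M : ℕ} {Ω : Fin M → Type*} [∀ i, Fintype (Ω i)]
    (p : ∀ i, Ω i → ℝ) (hp : ∀ i a, 0 ≤ p i a) (hp1 : ∑ ω : ∀ i, Ω i, ∏ i, p i (ω i) = 1)
    (A B : Set (∀ i, Ω i)) :
    ∑ ω : ∀ i, Ω i, (if ω ∈ disjointOccurrence A B then ∏ i, p i (ω i) else 0) ≤
      (∑ ω : ∀ i, Ω i, if ω ∈ A then ∏ i, p i (ω i) else 0) *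
        ∑ ω : ∀ i, Ω i, if ω ∈ B then ∏ i, p i (ω i) else 0 := by
  set w : (∀ i, Ω i) → ℝ := fun ω => ∏ i, p i (ω i) with hw
  have hw0 : ∀ ω, 0 ≤ w ω := fun ω => Finset.prod_nonneg fun i _ => hp i _
  have hmix : ∀ σ u v, w (mixPoint σ u v) * w (mixPoint σ v u) = w u * w v := by
    intro σ u v
    simp only [hw, ← Finset.prod_mul_distrib]
    refine Finset.prod_congr rfl fun i _ => ?_
    rcases Bool.eq_false_or_eq_true (σ i) with h | h <;> simp [mixPoint, h, mul_comm]
  -- For each fixed `σ`, the exchanged pair has the same law as the original pair.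
  have key : ∀ (f : (∀ i, Ω i) → (∀ i, Ω i) → ℝ) (σ : Fin M → Bool),
      ∑ q : (∀ i, Ω i) × (∀ i, Ω i),
        w q.1 * w q.2 * f (mixPoint σ q.1 q.2) (mixPoint σ q.2 q.1) =
      ∑ q : (∀ i, Ω i) × (∀ i, Ω i), w q.1 * w q.2 * f q.1 q.2 := by
    intro f σ
    rw [← Equiv.sum_comp (mixEquiv σ) fun q => w q.1 * w q.2 * f q.1 q.2]
    refine Finset.sum_congr rfl fun q _ => ?_
    simp only [mixEquiv, Equiv.coe_fn_mk, hmix]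
  have hcube : ∀ q : (∀ i, Ω i) × (∀ i, Ω i),
      ∑ σ : Fin M → Bool, (if mixPoint σ q.1 q.2 ∈ disjointOccurrence A B then (1 : ℝ) else 0) ≤
      ∑ σ : Fin M → Bool,
        (if mixPoint σ q.1 q.2 ∈ A ∧ mixPoint σ q.2 q.1 ∈ B then (1 : ℝ) else 0) := by
    intro q
    rw [Finset.sum_boole, Finset.sum_boole, Nat.cast_le]
    refine (card_disjointOccurrence_le
      (Finset.univ.filter fun σ : Fin M → Bool => mixPoint σ q.1 q.2 ∈ A)
      (Finset.univ.filter fun σ : Fin M → Bool => mixPoint σ q.1 q.2 ∈ B) _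
      fun σ hσ => ?_).trans (le_of_eq ?_)
    · simpa using mixPoint_mem_disjointOccurrence (Finset.mem_filter.1 hσ).2
    · congr 1
      ext σ
      simp [mixPoint_not]
  have hsum := Finset.sum_le_sum fun q (_ : q ∈ Finset.univ) =>
    mul_le_mul_of_nonneg_left (hcube q) (mul_nonneg (hw0 q.1) (hw0 q.2))
  simp only [Finset.mul_sum] at hsum
  rw [Finset.sum_comm, Finset.sum_comm (s := Finset.univ (α := (∀ i, Ω i) × (∀ i, Ω i)))] at hsum
  have hl := fun σ => key (fun u _ => if u ∈ disjointOccurrence A B then 1 else 0) σ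
  have hr := fun σ => key (fun u v => if u ∈ A ∧ v ∈ B then 1 else 0) σ
  simp only [hl, hr, Finset.sum_const, nsmul_eq_mul] at hsum
  have hpos : (0 : ℝ) < ((Finset.univ : Finset (Fin M → Bool)).card : ℝ) := by
    exact_mod_cast Finset.card_pos.2 Finset.univ_nonempty
  have h := le_of_mul_le_mul_left hsum hpos
  have h1 : ∑ q : (∀ i, Ω i) × (∀ i, Ω i),
      w q.1 * w q.2 * (if q.1 ∈ disjointOccurrence A B then 1 else 0) =
      ∑ ω, if ω ∈ disjointOccurrence A B then w ω else 0 := by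
    rw [Fintype.sum_prod_type]
    refine Finset.sum_congr rfl fun u _ => ?_
    by_cases hu : u ∈ disjointOccurrence A B <;> simp [hu, ← Finset.mul_sum, hp1]
  have h2 : ∑ q : (∀ i, Ω i) × (∀ i, Ω i), w q.1 * w q.2 * (if q.1 ∈ A ∧ q.2 ∈ B then 1 else 0) =
      (∑ ω, if ω ∈ A then w ω else 0) * ∑ ω, if ω ∈ B then w ω else 0 := by
    rw [Fintype.sum_prod_type, Finset.sum_mul_sum]
    refine Finset.sum_congr rfl fun u _ => Finset.sum_congr rfl fun v _ => ?_
    by_cases hu : u ∈ A <;> by_cases hv : v ∈ B <;> simp [hu, hv]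
  rwa [h1, h2] at h

theorem real_eq_sum_ite {α : Type*} [Fintype α] [MeasurableSpace α] [MeasurableSingletonClass α]
    (ν : Measure α) [IsFiniteMeasure ν] (S : Set α) [DecidablePred (· ∈ S)] :
    ν.real S = ∑ a, if a ∈ S then ν.real {a} else 0 := by
  rw [← Finset.sum_filter, sum_measureReal_singleton]
  congr 1
  ext a
  simp

/-- The van den Berg–Kesten–Reimer inequality. -/
theorem measureReal_disjointOccurrence_le {M : ℕ} {Ω : Fin M → Type*} [∀ i, Finite (Ω i)]
    [∀ i, MeasurableSpace (Ω i)] [∀ i, MeasurableSingletonClass (Ω i)]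
    (P : ∀ i, Measure (Ω i)) [∀ i, IsProbabilityMeasure (P i)] (A B : Set (∀ i, Ω i)) :
    (Measure.pi P).real (disjointOccurrence A B) ≤
      (Measure.pi P).real A * (Measure.pi P).real B := by
  classical
  have := fun i => Fintype.ofFinite (Ω i)
  have hs : ∀ ω : ∀ i, Ω i, (Measure.pi P).real {ω} = ∏ i, (P i).real {ω i} := by
    intro ω
    simp [measureReal_def, Measure.pi_singleton, ENNReal.toReal_prod]
  have h1 : ∑ ω : ∀ i, Ω i, ∏ i, (P i).real {ω i} = 1 := by
    simp only [← hs]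
    rw [sum_measureReal_singleton]
    simp
  rw [real_eq_sum_ite _ (disjointOccurrence A B), real_eq_sum_ite _ A, real_eq_sum_ite _ B]
  simp only [hs]
  convert sum_disjointOccurrence_le (fun i a => (P i).real {a}) (fun _ _ => measureReal_nonneg)
    h1 A B

/-! ### Disjoint occurrence of several events. -/

theorem OccurDisjointly.mono {M : ℕ} {Ω : Fin M → Type*} {I : Type*} {E : I → Set (∀ i, Ω i)}
    {ω : ∀ i, Ω i} {J J' : Finset I} (h : OccurDisjointly E ω J) (hJ : J' ⊆ J) :
    OccurDisjointly E ω J' := by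
  obtain ⟨K, hK, hE⟩ := h
  exact ⟨K, fun α hα β hβ => hK α (hJ hα) β (hJ hβ), fun α hα => hE α (hJ hα)⟩

theorem OccurDisjointly.mem_disjointOccurrence {M : ℕ} {Ω : Fin M → Type*} {I : Type*}
    [DecidableEq I] {E : I → Set (∀ i, Ω i)} {ω : ∀ i, Ω i} {a : I} {J : Finset I} (ha : a ∉ J)
    (h : OccurDisjointly E ω (insert a J)) :
    ω ∈ disjointOccurrence (E a) {ω | OccurDisjointly E ω J} := by
  obtain ⟨K, hK, hE⟩ := h
  -- The same sets `K α` certify `J` throughout the cylinder over their union.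
  refine ⟨K a, J.biUnion K, ?_, hE a (Finset.mem_insert_self a J), fun ω' hω' => ⟨K, ?_, ?_⟩⟩
  · rw [Finset.disjoint_biUnion_right]
    exact fun β hβ => hK a (Finset.mem_insert_self a J) β (Finset.mem_insert_of_mem hβ)
      fun h => ha (h ▸ hβ)
  · exact fun α hα β hβ => hK α (Finset.mem_insert_of_mem hα) β (Finset.mem_insert_of_mem hβ)
  · refine fun α hα ω'' hω'' => hE α (Finset.mem_insert_of_mem hα) fun i hi => ?_
    rw [hω'' i hi, hω' i (Finset.mem_biUnion.2 ⟨α, hα, hi⟩)]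

/-- The van den Berg–Kesten–Reimer inequality for several events. -/
theorem measureReal_occurDisjointly_le {M : ℕ} {Ω : Fin M → Type*} [∀ i, Finite (Ω i)]
    [∀ i, MeasurableSpace (Ω i)] [∀ i, MeasurableSingletonClass (Ω i)]
    (P : ∀ i, Measure (Ω i)) [∀ i, IsProbabilityMeasure (P i)]
    {I : Type*} (E : I → Set (∀ i, Ω i)) (J : Finset I) :
    (Measure.pi P).real {ω | OccurDisjointly E ω J} ≤ ∏ α ∈ J, (Measure.pi P).real (E α) := by
  classical
  induction J using Finset.induction_on with
  | empty => simp
  | insert a J ha ih =>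
    rw [Finset.prod_insert ha]
    calc (Measure.pi P).real {ω | OccurDisjointly E ω (insert a J)}
        ≤ (Measure.pi P).real (disjointOccurrence (E a) {ω | OccurDisjointly E ω J}) :=
          measureReal_mono fun ω hω => OccurDisjointly.mem_disjointOccurrence ha hω
      _ ≤ _ := measureReal_disjointOccurrence_le P _ _
      _ ≤ _ := mul_le_mul_of_nonneg_left ih measureReal_nonneg

/-- If only finitely many events are certain, then the number of events that can occur disjointly
is bounded. -/
theorem isGreatest_maxDisjoint {M : ℕ} {Ω : Fin M → Type*} {I : Type*} (E : I → Set (∀ i, Ω i))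
    (hE : {α | E α = Set.univ}.Finite) (ω : ∀ i, Ω i) :
    IsGreatest (disjointSizes E ω) (maxDisjoint E ω) := by
  classical
  have hbdd : BddAbove (disjointSizes E ω) := by
    -- Only certain events can use an empty `K α`; the others need disjoint nonempty subsets of the
    -- `M` coordinates.
    refine ⟨hE.toFinset.card + M, ?_⟩
    rintro n ⟨J, ⟨K, hK, hKE⟩, rfl⟩
    rw [← Finset.card_filter_add_card_filter_not (s := J) (fun α => E α = Set.univ)]
    refine add_le_add (Finset.card_le_card fun α hα => ?_) ?_
    · simpa using (Finset.mem_filter.1 hα).2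
    · have hne : ∀ α ∈ J.filter (fun α => ¬ E α = Set.univ), (K α).Nonempty := by
        intro α hα
        rw [Finset.mem_filter] at hα
        rw [Finset.nonempty_iff_ne_empty]
        intro h0
        refine hα.2 (Set.eq_univ_of_univ_subset fun ω' _ => hKE α hα.1 ?_)
        simp [h0, cylinderAt]
      calc (J.filter fun α => ¬ E α = Set.univ).card
          ≤ ∑ α ∈ J.filter (fun α => ¬ E α = Set.univ), (K α).card := by
            rw [Finset.card_eq_sum_ones]
            exact Finset.sum_le_sum fun α hα => (hne α hα).card_pos
        _ = ((J.filter fun α => ¬ E α = Set.univ).biUnion K).card := by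
            rw [Finset.card_biUnion]
            exact fun α hα β hβ => hK α (Finset.mem_filter.1 hα).1 β (Finset.mem_filter.1 hβ).1
        _ ≤ M := (Finset.card_le_univ _).trans (by simp)
  have hne : (disjointSizes E ω).Nonempty :=
    ⟨0, ∅, ⟨fun _ => ∅, by simp, by simp⟩, rfl⟩
  exact ⟨Nat.sSup_mem hne hbdd, fun n hn => le_csSup hbdd hn⟩

theorem finite_setOf_eq_univ_of_summable {M : ℕ} {Ω : Fin M → Type*}
    [∀ i, MeasurableSpace (Ω i)]
    (P : ∀ i, Measure (Ω i)) [∀ i, IsProbabilityMeasure (P i)]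
    {I : Type*} (E : I → Set (∀ i, Ω i))
    (hE : Summable fun α => (Measure.pi P).real (E α)) : {α | E α = Set.univ}.Finite := by
  have h := hE.tendsto_cofinite_zero.eventually_lt_const (zero_lt_one (α := ℝ))
  rw [Filter.eventually_cofinite] at h
  refine h.subset fun α hα => ?_
  rw [Set.mem_ofPred_eq] at hα
  simp [hα]

/-- Finitely many of the events suffice to attain all the values `Z(ω)`. -/
theorem exists_finset_maxDisjoint {M : ℕ} {Ω : Fin M → Type*} [∀ i, Finite (Ω i)]
    {I : Type*} (E : I → Set (∀ i, Ω i)) (hE : {α | E α = Set.univ}.Finite) :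
    ∃ F : Finset I, ∀ ω, ∃ J ⊆ F, OccurDisjointly E ω J ∧ J.card = maxDisjoint E ω := by
  classical
  have := fun i => Fintype.ofFinite (Ω i)
  choose J hJ using fun ω => (isGreatest_maxDisjoint E hE ω).1
  exact ⟨Finset.univ.biUnion J, fun ω =>
    ⟨J ω, Finset.subset_biUnion_of_mem J (Finset.mem_univ ω), hJ ω⟩⟩

/-! ### Tail bounds for `Z`. -/

/-- Elementary symmetric sums are at most the corresponding exponential-series terms. -/
theorem sum_powersetCard_prod_le {I : Type*} (p : I → ℝ) (hp : ∀ α, 0 ≤ p α) (F : Finset I)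
    (k : ℕ) :
    ∑ J ∈ F.powersetCard k, ∏ α ∈ J, p α ≤ (∑ α ∈ F, p α) ^ k / (k.factorial : ℝ) := by
  classical
  induction F using Finset.induction_on generalizing k with
  | empty =>
    cases k with
    | zero => simp
    | succ k => rw [Finset.powersetCard_eq_empty.2 (by simp)]; simp
  | insert a F ha ih =>
    cases k with
    | zero => simp
    | succ k =>
      have hF : 0 ≤ ∑ α ∈ F, p α := Finset.sum_nonneg fun α _ => hp α
      have hdisj : Disjoint (F.powersetCard (k + 1)) ((F.powersetCard k).image (insert a)) := by
        rw [Finset.disjoint_left]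
        intro J hJ hJ'
        obtain ⟨J₀, -, rfl⟩ := Finset.mem_image.1 hJ'
        exact ha ((Finset.mem_powersetCard.1 hJ).1 (Finset.mem_insert_self a J₀))
      have haJ : ∀ J ∈ F.powersetCard k, a ∉ J := fun J hJ h =>
        ha ((Finset.mem_powersetCard.1 hJ).1 h)
      rw [Finset.powersetCard_succ_insert ha, Finset.sum_union hdisj, Finset.sum_image,
        Finset.sum_congr rfl fun J hJ => Finset.prod_insert (haJ J hJ), ← Finset.mul_sum,
        Finset.sum_insert ha]
      · refine (add_le_add (ih (k + 1)) (mul_le_mul_of_nonneg_left (ih k) (hp a))).trans ?_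
        set s := ∑ α ∈ F, p α
        -- These are the first two terms of the binomial expansion; they come from subsets avoiding
        -- and containing `a`.
        have hbern : s ^ (k + 1) + (k + 1) * (s ^ k * p a) ≤ (p a + s) ^ (k + 1) := by
          have h := pow_add_mul_le_add_pow (a := s) (b := p a) hF (by linarith [hp a]) (k + 1)
          rw [add_comm (p a)]
          refine le_trans (le_of_eq ?_) h
          push_cast
          ring
        rw [Nat.factorial_succ]
        push_cast
        have hk : (0 : ℝ) < k.factorial := by positivity
        rw [le_div_iff₀ (by positivity)]
        refine le_trans (le_of_eq ?_) hbern
        field_simp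
      · intro J hJ J' hJ' h
        rw [← Finset.erase_insert (haJ J hJ), ← Finset.erase_insert (haJ J' hJ')]
        exact congrArg (fun s => s.erase a) h

section Tail

variable {M : ℕ} {Ω : Fin M → Type*} [∀ i, Finite (Ω i)]
    [∀ i, MeasurableSpace (Ω i)] [∀ i, MeasurableSingletonClass (Ω i)]
    (P : ∀ i, Measure (Ω i)) [∀ i, IsProbabilityMeasure (P i)]
    {I : Type*} (E : I → Set (∀ i, Ω i)) (μ : ℝ)

theorem measureReal_le_maxDisjoint_le
    (hE : Summable fun α => (Measure.pi P).real (E α))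
    (hμ : ∑' α, (Measure.pi P).real (E α) ≤ μ) (x : ℕ) :
    (Measure.pi P).real {ω | x ≤ maxDisjoint E ω} ≤ μ ^ x / (x.factorial : ℝ) := by
  classical
  obtain ⟨F, hF⟩ := exists_finset_maxDisjoint E (finite_setOf_eq_univ_of_summable P E hE)
  have hFμ : ∑ α ∈ F, (Measure.pi P).real (E α) ≤ μ :=
    (hE.sum_le_tsum F fun _ _ => measureReal_nonneg).trans hμ
  calc (Measure.pi P).real {ω | x ≤ maxDisjoint E ω}
      ≤ (Measure.pi P).real (⋃ J ∈ F.powersetCard x, {ω | OccurDisjointly E ω J}) := by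
        refine measureReal_mono (fun ω (hω : x ≤ maxDisjoint E ω) => ?_) (measure_ne_top _ _)
        obtain ⟨J, hJF, hJ, hJc⟩ := hF ω
        obtain ⟨J', hJ', hJ'c⟩ := Finset.exists_subset_card_eq (hJc ▸ hω)
        exact Set.mem_biUnion (Finset.mem_powersetCard.2 ⟨hJ'.trans hJF, hJ'c⟩) (hJ.mono hJ')
    _ ≤ ∑ J ∈ F.powersetCard x, (Measure.pi P).real {ω | OccurDisjointly E ω J} :=
        measureReal_biUnion_finset_le _ _
    _ ≤ ∑ J ∈ F.powersetCard x, ∏ α ∈ J, (Measure.pi P).real (E α) :=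
        Finset.sum_le_sum fun J _ => measureReal_occurDisjointly_le P E J
    _ ≤ (∑ α ∈ F, (Measure.pi P).real (E α)) ^ x / (x.factorial : ℝ) :=
        sum_powersetCard_prod_le _ (fun _ => measureReal_nonneg) F x
    _ ≤ μ ^ x / (x.factorial : ℝ) := by
        have := Finset.sum_nonneg fun α (_ : α ∈ F) =>
          measureReal_nonneg (μ := Measure.pi P) (s := E α)
        gcongr

/-- Chernoff's bound for `Z`, from the bound `exp (s μ)` on the mean of `(1 + s) ^ Z`. -/
theorem measureReal_le_maxDisjoint_le_exp
    (hE : Summable fun α => (Measure.pi P).real (E α))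
    (hμ : ∑' α, (Measure.pi P).real (E α) ≤ μ) {s : ℝ} (hs : 0 ≤ s) (y : ℝ) :
    (Measure.pi P).real {ω | y ≤ (maxDisjoint E ω : ℝ)} ≤ Real.exp (s * μ) * (1 + s) ^ (-y) := by
  classical
  have := fun i => Fintype.ofFinite (Ω i)
  obtain ⟨F, hF⟩ := exists_finset_maxDisjoint E (finite_setOf_eq_univ_of_summable P E hE)
  have hFμ : ∑ α ∈ F, (Measure.pi P).real (E α) ≤ μ :=
    (hE.sum_le_tsum F fun _ _ => measureReal_nonneg).trans hμ
  have hs1 : 0 < 1 + s := by linarith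
  have hpt : ∀ ω, (1 + s) ^ maxDisjoint E ω ≤
      ∑ J ∈ F.powerset, s ^ J.card * if OccurDisjointly E ω J then 1 else 0 := by
    intro ω
    obtain ⟨J, hJF, hJ, hJc⟩ := hF ω
    calc (1 + s) ^ maxDisjoint E ω = ∏ _α ∈ J, (1 + s) := by rw [Finset.prod_const, hJc]
      _ = ∑ J' ∈ J.powerset, s ^ J'.card := by
          rw [Finset.prod_one_add]
          exact Finset.sum_congr rfl fun J' _ => Finset.prod_const s
      _ = ∑ J' ∈ J.powerset, s ^ J'.card * if OccurDisjointly E ω J' then 1 else 0 :=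
          Finset.sum_congr rfl fun J' hJ' => by simp [hJ.mono (Finset.mem_powerset.1 hJ')]
      _ ≤ _ := Finset.sum_le_sum_of_subset_of_nonneg (Finset.powerset_mono.2 hJF)
          fun J' _ _ => mul_nonneg (pow_nonneg hs _) (by split_ifs <;> norm_num)
  have hmean : ∑ ω, (Measure.pi P).real {ω} * (1 + s) ^ maxDisjoint E ω ≤ Real.exp (s * μ) := by
    calc ∑ ω, (Measure.pi P).real {ω} * (1 + s) ^ maxDisjoint E ω
        ≤ ∑ ω, (Measure.pi P).real {ω} *
            ∑ J ∈ F.powerset, s ^ J.card * if OccurDisjointly E ω J then 1 else 0 :=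
          Finset.sum_le_sum fun ω _ => mul_le_mul_of_nonneg_left (hpt ω) measureReal_nonneg
      _ = ∑ J ∈ F.powerset, s ^ J.card * (Measure.pi P).real {ω | OccurDisjointly E ω J} := by
          simp_rw [Finset.mul_sum]
          rw [Finset.sum_comm]
          refine Finset.sum_congr rfl fun J _ => ?_
          rw [real_eq_sum_ite, Finset.mul_sum]
          refine Finset.sum_congr rfl fun ω _ => ?_
          by_cases h : OccurDisjointly E ω J <;> simp [h, mul_comm]
      _ ≤ ∑ J ∈ F.powerset, s ^ J.card * ∏ α ∈ J, (Measure.pi P).real (E α) :=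
          Finset.sum_le_sum fun J _ => mul_le_mul_of_nonneg_left
            (measureReal_occurDisjointly_le P E J) (pow_nonneg hs _)
      _ = ∏ α ∈ F, (1 + s * (Measure.pi P).real (E α)) := by
          rw [Finset.prod_one_add]
          exact Finset.sum_congr rfl fun J _ => by rw [Finset.prod_mul_distrib, Finset.prod_const]
      _ ≤ ∏ α ∈ F, Real.exp (s * (Measure.pi P).real (E α)) :=
          Finset.prod_le_prod
            (fun α _ => add_nonneg zero_le_one (mul_nonneg hs measureReal_nonneg))
            fun α _ => by rw [add_comm]; exact Real.add_one_le_exp _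
      _ = Real.exp (s * ∑ α ∈ F, (Measure.pi P).real (E α)) := by
          rw [← Real.exp_sum, Finset.mul_sum]
      _ ≤ Real.exp (s * μ) := Real.exp_le_exp.2 (mul_le_mul_of_nonneg_left hFμ hs)
  have hmarkov : (Measure.pi P).real {ω | y ≤ (maxDisjoint E ω : ℝ)} * (1 + s) ^ y ≤
      ∑ ω, (Measure.pi P).real {ω} * (1 + s) ^ maxDisjoint E ω := by
    rw [real_eq_sum_ite, Finset.sum_mul]
    refine Finset.sum_le_sum fun ω _ => ?_
    by_cases h : y ≤ (maxDisjoint E ω : ℝ)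
    · simp only [Set.mem_ofPred_eq, h, if_true]
      refine mul_le_mul_of_nonneg_left ?_ measureReal_nonneg
      rw [← Real.rpow_natCast]
      exact Real.rpow_le_rpow_of_exponent_le (by linarith) h
    · simp only [Set.mem_ofPred_eq, h, if_false, zero_mul]
      exact mul_nonneg measureReal_nonneg (by positivity)
  rw [Real.rpow_neg hs1.le, ← div_eq_mul_inv, le_div_iff₀ (by positivity)]
  exact hmarkov.trans hmean

end Tail

/-! ### Estimates for `φ` and the theorem. -/

/-- From `log (1 + x) ≥ 2x / (x + 2)` follows `x ≤ (1 + x / 2) log (1 + x)`, hence `φ(x) ≥ (x / 2)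
log (1 + x)`. -/
theorem half_mul_log_le_chernoffPhi {x : ℝ} (hx : 0 ≤ x) :
    x / 2 * Real.log (1 + x / 2) ≤ chernoffPhi x := by
  have h1 := Real.le_log_one_add_of_nonneg hx
  have h2 : Real.log (1 + x / 2) ≤ Real.log (1 + x) :=
    Real.log_le_log (by linarith) (by linarith)
  rw [div_le_iff₀ (by linarith)] at h1
  unfold chernoffPhi
  nlinarith

/-- Isolating `log (1 + x)` leaves a rational lower bound; the difference vanishes at `0` and has
nonnegative derivative. -/
theorem sq_div_le_chernoffPhi {x : ℝ} (hx : 0 ≤ x) :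
    x ^ 2 / (2 * (1 + x / 3)) ≤ chernoffPhi x := by
  have hd : ∀ y ∈ Set.Ici (0 : ℝ), HasDerivAt
      (fun y : ℝ => Real.log (1 + y) - (6 * y + 5 * y ^ 2) / (2 * (3 + y) * (1 + y)))
      (y ^ 3 / ((3 + y) ^ 2 * (1 + y) ^ 2)) y := by
    intro y (hy : 0 ≤ y)
    have h1 : 1 + y ≠ 0 := by positivity
    have h3 : 3 + y ≠ 0 := by positivity
    have hl : HasDerivAt (fun y : ℝ => 1 + y) 1 y := (hasDerivAt_id y).const_add 1
    have hl3 : HasDerivAt (fun y : ℝ => 3 + y) 1 y := (hasDerivAt_id y).const_add 3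
    have hn : HasDerivAt (fun y : ℝ => 6 * y + 5 * y ^ 2) (6 + 10 * y) y := by
      refine (((hasDerivAt_id y).const_mul 6).add
        (((hasDerivAt_id y).pow 2).const_mul 5)).congr_deriv ?_
      simp
      ring
    have hm : HasDerivAt (fun y : ℝ => 2 * (3 + y) * (1 + y))
        (2 * 1 * (1 + y) + 2 * (3 + y) * 1) y := (hl3.const_mul 2).mul hl
    refine ((hl.log h1).sub (hn.div hm (by simp [h1, h3]))).congr_deriv ?_
    field_simp
    ring
  have hmono := monotoneOn_of_deriv_nonneg (convex_Ici (0 : ℝ))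
    (fun y hy => (hd y hy).continuousAt.continuousWithinAt)
    (fun y hy => (hd y (interior_subset hy)).differentiableAt.differentiableWithinAt)
    (fun y hy => by
      rw [(hd y (interior_subset hy)).deriv]
      have : 0 ≤ y := interior_subset hy
      positivity)
  have h := hmono (Set.mem_Ici.2 le_rfl) (Set.mem_Ici.2 hx) hx
  simp only [add_zero, Real.log_one] at h
  norm_num at h
  have e : (1 + x) * ((6 * x + 5 * x ^ 2) / (2 * (3 + x) * (1 + x))) - x =
      x ^ 2 / (2 * (1 + x / 3)) := by
    field_simp
    ring
  rw [← e, chernoffPhi]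
  gcongr

theorem exp_neg_chernoffPhi_eq {μ t : ℝ} (hμ : 0 < μ) (ht : 0 < t) :
    Real.exp (-(chernoffPhi (t / μ) * μ)) =
      Real.exp (-μ) * (Real.exp 1 * μ / (μ + t)) ^ (μ + t) := by
  have hb : 0 < Real.exp 1 * μ / (μ + t) := by positivity
  rw [Real.rpow_def_of_pos hb, ← Real.exp_add]
  congr 1
  have e : 1 + t / μ = (μ + t) / μ := by field_simp
  rw [chernoffPhi, e, Real.log_div (by positivity) (by positivity),
    Real.log_div (by positivity) (by positivity), Real.log_mul (by positivity) (by positivity),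
    Real.log_exp]
  field_simp
  ring

theorem mainTheorem7 {M : ℕ} {Ω : Fin M → Type*} [∀ i, Finite (Ω i)]
    [∀ i, MeasurableSpace (Ω i)] [∀ i, MeasurableSingletonClass (Ω i)]
    (P : ∀ i, Measure (Ω i)) [∀ i, IsProbabilityMeasure (P i)]
    {I : Type*} (E : I → Set (∀ i, Ω i)) (μ : ℝ)
    (hE : Summable fun α => (Measure.pi P).real (E α))
    (hμ : ∑' α, (Measure.pi P).real (E α) ≤ μ) :
    -- the maximum that defines `Z` is attained
    (∀ ω, IsGreatest (disjointSizes E ω) (maxDisjoint E ω)) ∧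
    (∀ t : ℝ, 0 < t →
      (0 < μ →
        (Measure.pi P).real {ω | μ + t ≤ (maxDisjoint E ω : ℝ)}
            ≤ Real.exp (-(chernoffPhi (t / μ) * μ)) ∧
        Real.exp (-(chernoffPhi (t / μ) * μ))
            = Real.exp (-μ) * (Real.exp 1 * μ / (μ + t)) ^ (μ + t) ∧
        Real.exp (-μ) * (Real.exp 1 * μ / (μ + t)) ^ (μ + t)
            ≤ min (Real.exp (-(t ^ 2 / (2 * (μ + t / 3))))) ((1 + t / (2 * μ)) ^ (-(t / 2)))) ∧
      -- for `μ = 0` the bounds above are read as their limit, which is zero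
      (μ = 0 → (Measure.pi P).real {ω | μ + t ≤ (maxDisjoint E ω : ℝ)} = 0)) ∧
    (∀ x : ℕ, 1 ≤ x →
      (Measure.pi P).real {ω | x ≤ maxDisjoint E ω} ≤ μ ^ x / (x.factorial : ℝ) ∧
      μ ^ x / (x.factorial : ℝ)
        ≤ (Real.exp 1 * μ / (x : ℝ)) ^ x / Real.sqrt (2 * Real.pi * (x : ℝ))) := by
  have hμ0 : 0 ≤ μ := (tsum_nonneg fun _ => measureReal_nonneg).trans hμ
  have htail := measureReal_le_maxDisjoint_le P E μ hE hμ
  refine ⟨isGreatest_maxDisjoint E (finite_setOf_eq_univ_of_summable P E hE), fun t ht =>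
    ⟨fun hpos => ⟨?_, exp_neg_chernoffPhi_eq hpos ht, ?_⟩, fun h0 => ?_⟩,
    fun x hx => ⟨htail x, ?_⟩⟩
  -- The choice `s = t / μ` minimises `exp (s μ) (1 + s) ^ (-(μ + t))`.
  · refine (measureReal_le_maxDisjoint_le_exp P E μ hE hμ (div_pos ht hpos).le (μ + t)).trans
      (le_of_eq ?_)
    rw [Real.rpow_def_of_pos (by positivity), ← Real.exp_add, chernoffPhi]
    congr 1
    field_simp
    ring
  · rw [← exp_neg_chernoffPhi_eq hpos ht]
    have hx : 0 ≤ t / μ := (div_pos ht hpos).le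
    refine le_min (Real.exp_le_exp.2 (neg_le_neg ?_)) ?_
    · refine le_trans (le_of_eq ?_)
        (mul_le_mul_of_nonneg_right (sq_div_le_chernoffPhi hx) hμ0)
      field_simp
    · rw [Real.rpow_def_of_pos (by positivity)]
      refine Real.exp_le_exp.2 ?_
      have h := mul_le_mul_of_nonneg_right (half_mul_log_le_chernoffPhi hx) hμ0
      have e1 : t / μ / 2 = t / (2 * μ) := by field_simp
      have e2 : t / (2 * μ) * Real.log (1 + t / (2 * μ)) * μ =
          Real.log (1 + t / (2 * μ)) * (t / 2) := by field_simp
      rw [e1, e2] at h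
      linarith
  -- Since `Z` is an integer, `Z ≥ t > 0` forces `Z ≥ 1`, whose probability is at most `μ = 0`.
  · refine le_antisymm ?_ measureReal_nonneg
    refine le_trans (measureReal_mono fun ω hω => ?_) ((htail 1).trans (by simp [h0]))
    rw [Set.mem_ofPred_eq, h0, zero_add] at hω
    exact Nat.cast_pos.1 (ht.trans_le hω)
  · have hx0 : (0 : ℝ) < x := by exact_mod_cast hx
    have hst := Stirling.le_factorial_stirling x
    calc μ ^ x / (x.factorial : ℝ)
        ≤ μ ^ x / (√(2 * Real.pi * x) * (x / Real.exp 1) ^ x) := by gcongr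
      _ = _ := by
        rw [div_pow, div_pow, mul_pow]
        field_simp
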